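/- Let $A,B\in\mathbb{R}^{n\times n}$ and $b\in\mathbb{R}^n$. For $x\in\mathbb{R}^n$ write $|x|=(|x_1|,\dots,|x_n|)^\top$, and let $[-I_n,I_n]$ be the set of matrices $D\in\mathbb{R}^{n\times n}$ with $-I_n\le D\le I_n$ entrywise (that is, the diagonal matrices with diagonal entries in $[-1,1]$). Suppose that $A+BD$ is nonsingular for every $D\in[-I_n,I_n]$. Then the equation $Ax-B|x|=b$ has a unique solution $x^*\in\mathbb{R}^n$, and for every nonsingular matrix $M\in\mathbb{R}^{n\times n}$ and every norm $\|\cdot\|$ on $\mathbb{R}^n$, with the matrix norm it induces denoted by the same symbol, $$\|x-x^*\|\le \max_{D\in[-I_n,I_n]}\bigl\|(MA+MBD)^{-1}\bigr\|\cdot\bigl\|M(Ax-B|x|-b)\bigr\|\qquad\text{for all }x\in\mathbb{R}^n,$$ where the maximum is attained. -/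

import Mathlib

open scoped Matrix

/-- The interval matrix `[P, Q]`: all matrices `D` with `P ≤ D ≤ Q` entrywise. -/
def intervalMatrix {m n : ℕ} (P Q : Matrix (Fin m) (Fin n) ℝ) :
    Set (Matrix (Fin m) (Fin n) ℝ) :=
  {D | ∀ i j, P i j ≤ D i j ∧ D i j ≤ Q i j}

/-- The map `x ↦ A x - B |x|`, where `|x|` is the componentwise absolute value. -/
def gaveMap {m n : ℕ} (A B : Matrix (Fin m) (Fin n) ℝ) (x : Fin n → ℝ) : Fin m → ℝ :=
  A *ᵥ x - B *ᵥ (fun i => |x i|)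

/-- `x` solves the generalized absolute value equation `A x - B |x| = b`. -/
def IsGAVESolution {m n : ℕ} (A B : Matrix (Fin m) (Fin n) ℝ) (b : Fin m → ℝ)
    (x : Fin n → ℝ) : Prop :=
  gaveMap A B x = b

/-- A (vector) norm: a seminorm that vanishes only at `0`. -/
def IsVectorNorm {n : ℕ} (ν : Seminorm ℝ (Fin n → ℝ)) : Prop :=
  ∀ v, ν v = 0 → v = 0

/-- The matrix norm induced by `ν`: the supremum of `ν (C v)` over the unit ball of `ν`.
For a norm `ν` on the finite-dimensional space `ℝⁿ`, this is the supremum of a nonempty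
bounded set. -/
noncomputable def inducedNorm {n : ℕ} (ν : Seminorm ℝ (Fin n → ℝ))
    (C : Matrix (Fin n) (Fin n) ℝ) : ℝ :=
  sSup {r : ℝ | ∃ v : Fin n → ℝ, ν v ≤ 1 ∧ r = ν (C *ᵥ v)}

/-! Secant slopes of the absolute value lie in `[-1, 1]`, so for `|t| ≤ 1` the increment of `x ↦ A x
- t B |x|` between two points is `(A + B D)(x - y)` for some admissible `D`
(`exists_gaveMap_sub_eq`). Inverting `M (A + B D)` gives the error bound; compactness of the set of
`D` makes the maximum attained. With `M = 1` the bound is uniform in `t`, so it yields injectivity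
and lets surjectivity travel in equal steps from `t = 0`, where `A` is invertible, to `t = 1`. -/

theorem Seminorm.continuous_of_finiteDimensional_pi {n : ℕ} (ν : Seminorm ℝ (Fin n → ℝ)) :
    Continuous ν :=
  (ν.convexOn.locallyLipschitz).continuous

theorem IsVectorNorm.isCompact_unitBall {n : ℕ} {ν : Seminorm ℝ (Fin n → ℝ)}
    (hν : IsVectorNorm ν) : IsCompact {v : Fin n → ℝ | ν v ≤ 1} := by
  have hc := ν.continuous_of_finiteDimensional_pi
  refine Metric.isCompact_of_isClosed_isBounded (isClosed_le hc continuous_const) ?_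
  -- The sphere is empty only when `n = 0`; otherwise the minimum of `ν` on it is positive and
  -- bounds the ball.
  rcases (Metric.sphere (0 : Fin n → ℝ) 1).eq_empty_or_nonempty with he | hne
  · refine (Metric.isBounded_closedBall (x := (0 : Fin n → ℝ)) (r := 0)).subset fun v _ => ?_
    by_contra hv
    have hv0 : v ≠ 0 := by rintro rfl; simp at hv
    have : ‖v‖⁻¹ • v ∈ Metric.sphere (0 : Fin n → ℝ) 1 := by
      simp [norm_smul, norm_ne_zero_iff.mpr hv0]
    simp [he] at this
  · obtain ⟨w, hw, hmin⟩ := (isCompact_sphere (0 : Fin n → ℝ) 1).exists_isMinOn hne hc.continuousOn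
    have hw0 : 0 < ν w := by
      refine lt_of_le_of_ne (apply_nonneg ν w) fun h => ?_
      have := hν w h.symm
      simp [this] at hw
    refine (Metric.isBounded_closedBall (x := (0 : Fin n → ℝ)) (r := (ν w)⁻¹)).subset
      fun v hv => ?_
    rw [mem_closedBall_zero_iff]
    rcases eq_or_ne v 0 with rfl | hv0
    · simp
    have hpos : 0 < ‖v‖ := norm_pos_iff.mpr hv0
    have hmem : ‖v‖⁻¹ • v ∈ Metric.sphere (0 : Fin n → ℝ) 1 := by
      simp [norm_smul, hpos.ne']
    have h1 : ν w ≤ ν (‖v‖⁻¹ • v) := hmin hmem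
    rw [map_smul_eq_mul, norm_inv, norm_norm] at h1
    have h2 : ν w ≤ ‖v‖⁻¹ * 1 := h1.trans (by gcongr; exact hv)
    rw [mul_one] at h2
    exact (le_inv_comm₀ hw0 hpos).mp h2

theorem inducedNorm_eq_sSup_image {n : ℕ} (ν : Seminorm ℝ (Fin n → ℝ))
    (C : Matrix (Fin n) (Fin n) ℝ) :
    inducedNorm ν C = sSup ((fun v => ν (C *ᵥ v)) '' {v | ν v ≤ 1}) := by
  unfold inducedNorm
  congr 1
  ext r
  simp [eq_comm]

theorem IsVectorNorm.continuous_inducedNorm {n : ℕ} {ν : Seminorm ℝ (Fin n → ℝ)}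
    (hν : IsVectorNorm ν) : Continuous (inducedNorm ν) := by
  rw [funext (inducedNorm_eq_sSup_image ν)]
  refine hν.isCompact_unitBall.continuous_sSup
    (f := fun (C : Matrix (Fin n) (Fin n) ℝ) v => ν (C *ᵥ v)) ?_
  exact ν.continuous_of_finiteDimensional_pi.comp (continuous_fst.matrix_mulVec continuous_snd)

theorem IsVectorNorm.le_inducedNorm_mul {n : ℕ} {ν : Seminorm ℝ (Fin n → ℝ)}
    (hν : IsVectorNorm ν) (C : Matrix (Fin n) (Fin n) ℝ) (v : Fin n → ℝ) :
    ν (C *ᵥ v) ≤ inducedNorm ν C * ν v := by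
  rcases eq_or_ne v 0 with rfl | hv
  · simp
  have hpos : 0 < ν v := lt_of_le_of_ne (apply_nonneg ν v) fun h => hv (hν v h.symm)
  have hcont : Continuous fun v => ν (C *ᵥ v) :=
    ν.continuous_of_finiteDimensional_pi.comp (continuous_const.matrix_mulVec continuous_id)
  have h : ν (C *ᵥ ((ν v)⁻¹ • v)) ≤ inducedNorm ν C := by
    rw [inducedNorm_eq_sSup_image]
    refine le_csSup (hν.isCompact_unitBall.image hcont).bddAbove ⟨(ν v)⁻¹ • v, ?_, rfl⟩
    simp [map_smul_eq_mul, abs_of_pos hpos, hpos.ne']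
  rw [Matrix.mulVec_smul, map_smul_eq_mul, Real.norm_of_nonneg (inv_nonneg.mpr hpos.le)] at h
  rwa [← div_le_iff₀ hpos, div_eq_inv_mul]

theorem isVectorNorm_normSeminorm (n : ℕ) : IsVectorNorm (normSeminorm ℝ (Fin n → ℝ)) :=
  fun _ hv => norm_eq_zero.mp hv

theorem isCompact_intervalMatrix {m n : ℕ} (P Q : Matrix (Fin m) (Fin n) ℝ) :
    IsCompact (intervalMatrix P Q) := by
  have h := isCompact_univ_pi fun i => isCompact_univ_pi fun j =>
    (isCompact_Icc : IsCompact (Set.Icc (P i j) (Q i j)))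
  have heq : intervalMatrix P Q =
      Set.univ.pi fun i => Set.univ.pi fun j => Set.Icc (P i j) (Q i j) := by
    ext D
    exact ⟨fun h i _ j _ => h i j, fun h i j => h i trivial j trivial⟩
  rw [heq]
  exact h

theorem diagonal_mem_intervalMatrix {n : ℕ} {d : Fin n → ℝ} (hd : ∀ i, |d i| ≤ 1) :
    Matrix.diagonal d ∈ intervalMatrix (-1 : Matrix (Fin n) (Fin n) ℝ) 1 := by
  intro i j
  rcases eq_or_ne i j with rfl | hij
  · simpa using abs_le.mp (hd i)
  · simp [hij]

theorem zero_mem_intervalMatrix (n : ℕ) :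
    (0 : Matrix (Fin n) (Fin n) ℝ) ∈ intervalMatrix (-1 : Matrix (Fin n) (Fin n) ℝ) 1 := by
  simpa using diagonal_mem_intervalMatrix (d := fun _ : Fin n => (0 : ℝ)) (by simp)

/-- The induced norms of the inverses attain a maximum over a compact set of matrices
parametrising nonsingular ones. -/
theorem exists_isGreatest_inducedNorm_inv {n : ℕ} {A B M : Matrix (Fin n) (Fin n) ℝ}
    (hAB : ∀ D ∈ intervalMatrix (-1 : Matrix (Fin n) (Fin n) ℝ) 1, IsUnit (A + B * D))
    (hM : IsUnit M) {ν : Seminorm ℝ (Fin n → ℝ)} (hν : IsVectorNorm ν) :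
    ∃ κ : ℝ, IsGreatest ((fun D => inducedNorm ν (M * A + M * B * D)⁻¹) ''
      intervalMatrix (-1 : Matrix (Fin n) (Fin n) ℝ) 1) κ := by
  have hlin : Continuous fun D : Matrix (Fin n) (Fin n) ℝ => M * A + M * B * D := by fun_prop
  have hinv : ContinuousOn (fun D => (M * A + M * B * D)⁻¹)
      (intervalMatrix (-1 : Matrix (Fin n) (Fin n) ℝ) 1) := by
    simp only [Matrix.inv_def, Ring.inverse_eq_inv']
    refine (hlin.matrix_det.continuousOn.inv₀ fun D hD => ?_).smul
      hlin.matrix_adjugate.continuousOn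
    have : IsUnit (M * A + M * B * D) := by
      rw [Matrix.mul_assoc, ← Matrix.mul_add]
      exact hM.mul (hAB D hD)
    exact ((Matrix.isUnit_iff_isUnit_det _).mp this).ne_zero
  exact ((isCompact_intervalMatrix _ _).image_of_continuousOn
    (hν.continuous_inducedNorm.comp_continuousOn hinv)).exists_isGreatest
      ⟨_, 0, zero_mem_intervalMatrix n, rfl⟩

theorem exists_gaveMap_sub_eq {n : ℕ} (A B : Matrix (Fin n) (Fin n) ℝ) {t : ℝ} (ht : |t| ≤ 1)
    (x y : Fin n → ℝ) :
    ∃ D ∈ intervalMatrix (-1 : Matrix (Fin n) (Fin n) ℝ) 1,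
      gaveMap A (t • B) x - gaveMap A (t • B) y = (A + B * D) *ᵥ (x - y) := by
  -- The factor `t` is absorbed into `D`. Where `x i = y i` the quotient is `0` by convention, and
  -- both increments vanish.
  let d : Fin n → ℝ := fun i => -(t * ((|x i| - |y i|) / (x i - y i)))
  refine ⟨Matrix.diagonal d, diagonal_mem_intervalMatrix fun i => ?_, ?_⟩
  · simp only [d, abs_neg, abs_mul, abs_div]
    exact mul_le_one₀ ht (by positivity)
      (div_le_one_of_le₀ (abs_abs_sub_abs_le _ _) (abs_nonneg _))
  · have hd : Matrix.diagonal d *ᵥ (x - y) = -(t • ((fun i => |x i|) - fun i => |y i|)) := by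
      ext i
      simp only [Matrix.mulVec_diagonal, d, Pi.sub_apply, Pi.neg_apply, Pi.smul_apply, smul_eq_mul]
      rcases eq_or_ne (x i) (y i) with h | h
      · simp [h]
      · have := sub_ne_zero.mpr h
        field_simp
    rw [Matrix.add_mulVec, ← Matrix.mulVec_mulVec, hd]
    simp only [gaveMap, Matrix.mulVec_sub, Matrix.mulVec_neg, Matrix.mulVec_smul,
      Matrix.smul_mulVec, smul_sub]
    abel

theorem norm_sub_le_mul_gaveMap {n : ℕ} {A B M : Matrix (Fin n) (Fin n) ℝ}
    (hAB : ∀ D ∈ intervalMatrix (-1 : Matrix (Fin n) (Fin n) ℝ) 1, IsUnit (A + B * D))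
    (hM : IsUnit M) {ν : Seminorm ℝ (Fin n → ℝ)} (hν : IsVectorNorm ν) {κ : ℝ}
    (hκ : κ ∈ upperBounds ((fun D => inducedNorm ν (M * A + M * B * D)⁻¹) ''
      intervalMatrix (-1 : Matrix (Fin n) (Fin n) ℝ) 1))
    {t : ℝ} (ht : |t| ≤ 1) (x y : Fin n → ℝ) :
    ν (x - y) ≤ κ * ν (M *ᵥ (gaveMap A (t • B) x - gaveMap A (t • B) y)) := by
  obtain ⟨D, hD, hxy⟩ := exists_gaveMap_sub_eq A B ht x y
  have hE : M * A + M * B * D = M * (A + B * D) := by rw [Matrix.mul_assoc, ← Matrix.mul_add]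
  have hu : IsUnit (M * A + M * B * D).det := by
    rw [← Matrix.isUnit_iff_isUnit_det, hE]
    exact hM.mul (hAB D hD)
  rw [hxy, Matrix.mulVec_mulVec, ← hE]
  calc ν (x - y)
      = ν ((M * A + M * B * D)⁻¹ *ᵥ ((M * A + M * B * D) *ᵥ (x - y))) := by
        rw [Matrix.mulVec_mulVec, Matrix.nonsing_inv_mul _ hu, Matrix.one_mulVec]
    _ ≤ inducedNorm ν (M * A + M * B * D)⁻¹ * ν ((M * A + M * B * D) *ᵥ (x - y)) :=
        hν.le_inducedNorm_mul _ _
    _ ≤ _ := by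
        gcongr
        exact hκ ⟨D, hD, rfl⟩

/-- Continuation step: surjectivity of `x ↦ A x - t B |x|` persists under small changes of `t`,
by the contraction principle. -/
theorem gaveMap_smul_surjective_of_near {n : ℕ} {A B : Matrix (Fin n) (Fin n) ℝ} {K L s t : ℝ}
    (hK0 : 0 ≤ K)
    (hK : ∀ x y, ‖x - y‖ ≤ K * ‖gaveMap A (t • B) x - gaveMap A (t • B) y‖)
    (hL0 : 0 ≤ L) (hL : ∀ v, ‖B *ᵥ v‖ ≤ L * ‖v‖) (hst : |s - t| * (K * L) < 1)
    (hsurj : Function.Surjective (gaveMap A (t • B))) :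
    Function.Surjective (gaveMap A (s • B)) := by
  intro c
  choose G hG using hsurj
  -- A fixed point of `T` solves the equation for `s`, with the excess `(s - t) B |x|` moved to the
  -- right-hand side.
  let T : (Fin n → ℝ) → (Fin n → ℝ) := fun x => G (c + (s - t) • B *ᵥ fun i => |x i|)
  have hT : ContractingWith ⟨|s - t| * (K * L), by positivity⟩ T := by
    refine ⟨hst, LipschitzWith.of_dist_le_mul fun x y => ?_⟩
    rw [dist_eq_norm, dist_eq_norm]
    have habs : ‖(fun i => |x i|) - fun i => |y i|‖ ≤ ‖x - y‖ :=
      (pi_norm_le_iff_of_nonneg (norm_nonneg _)).mpr fun i =>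
        (abs_abs_sub_abs_le (x i) (y i)).trans (norm_le_pi_norm (x - y) i)
    calc ‖T x - T y‖ ≤ K * ‖gaveMap A (t • B) (T x) - gaveMap A (t • B) (T y)‖ := hK _ _
      _ = K * (|s - t| * ‖B *ᵥ ((fun i => |x i|) - fun i => |y i|)‖) := by
        simp only [T, hG]
        rw [add_sub_add_left_eq_sub, ← smul_sub, ← Matrix.mulVec_sub, norm_smul, Real.norm_eq_abs]
      _ ≤ K * (|s - t| * (L * ‖x - y‖)) := by
        gcongr
        exact (hL _).trans (by gcongr)
      _ = |s - t| * (K * L) * ‖x - y‖ := by ring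
  refine ⟨hT.fixedPoint T, ?_⟩
  have hfix : T (hT.fixedPoint T) = hT.fixedPoint T := hT.fixedPoint_isFixedPt
  set z := hT.fixedPoint T
  have hz : gaveMap A (t • B) z = c + (s - t) • B *ᵥ fun i => |z i| := by
    conv_lhs => rw [← hfix]
    exact hG _
  simp only [gaveMap, Matrix.smul_mulVec, sub_smul] at hz ⊢
  rw [sub_eq_iff_eq_add] at hz ⊢
  rw [hz]
  abel

theorem gaveMap_bijective {n : ℕ} {A B : Matrix (Fin n) (Fin n) ℝ}
    (hAB : ∀ D ∈ intervalMatrix (-1 : Matrix (Fin n) (Fin n) ℝ) 1, IsUnit (A + B * D)) :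
    Function.Bijective (gaveMap A B) := by
  obtain ⟨κ, hκ⟩ := exists_isGreatest_inducedNorm_inv hAB isUnit_one (isVectorNorm_normSeminorm n)
  let K := max κ 0
  have hK : ∀ t : ℝ, |t| ≤ 1 → ∀ x y : Fin n → ℝ,
      ‖x - y‖ ≤ K * ‖gaveMap A (t • B) x - gaveMap A (t • B) y‖ := by
    intro t ht x y
    have h := norm_sub_le_mul_gaveMap hAB isUnit_one (isVectorNorm_normSeminorm n) hκ.2 ht x y
    simp only [Matrix.one_mulVec, coe_normSeminorm] at h
    exact h.trans (by gcongr; exact le_max_left _ _)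
  let L := ‖B.mulVecLin.toContinuousLinearMap‖
  have hL : ∀ v, ‖B *ᵥ v‖ ≤ L * ‖v‖ := B.mulVecLin.toContinuousLinearMap.le_opNorm
  -- Steps of length `1 / N` have contraction factor `K * L / N < 1`; the `0` forces `N > 0`.
  obtain ⟨N, hN⟩ := exists_nat_gt (max (K * L) 0)
  have hN0 : (0 : ℝ) < N := (le_max_right _ _).trans_lt hN
  have hsurj : ∀ k : ℕ, k ≤ N → Function.Surjective (gaveMap A (((k : ℝ) / N) • B)) := by
    intro k
    induction k with
    | zero =>
      intro _ c
      have hA : IsUnit A := by simpa using hAB 0 (zero_mem_intervalMatrix n)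
      refine ⟨A⁻¹ *ᵥ c, ?_⟩
      simp [gaveMap, Matrix.mulVec_mulVec,
        Matrix.mul_nonsing_inv _ ((Matrix.isUnit_iff_isUnit_det _).mp hA)]
    | succ k ih =>
      intro hk
      have hkN : (k : ℝ) ≤ N := by exact_mod_cast (Nat.le_succ k).trans hk
      refine gaveMap_smul_surjective_of_near (le_max_right κ 0) (hK (k / N) ?_) (norm_nonneg _) hL
        ?_ (ih ((Nat.le_succ k).trans hk))
      · rw [abs_of_nonneg (by positivity)]
        exact div_le_one_of_le₀ hkN hN0.le
      · have : ((k + 1 : ℕ) : ℝ) / N - k / N = 1 / N := by push_cast; ring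
        rw [this, abs_of_pos (by positivity), one_div, ← div_eq_inv_mul, div_lt_one hN0]
        exact (le_max_left _ _).trans_lt hN
  constructor
  · intro x y hxy
    have h := hK 1 (by simp) x y
    simpa [hxy, sub_eq_zero] using h
  · simpa [hN0.ne'] using hsurj N le_rfl

theorem corollary3p9 (n : ℕ) (A B : Matrix (Fin n) (Fin n) ℝ) (b : Fin n → ℝ)
    (hAB : ∀ D ∈ intervalMatrix (-1 : Matrix (Fin n) (Fin n) ℝ) 1, IsUnit (A + B * D)) :
    (∃! xs : Fin n → ℝ, IsGAVESolution A B b xs) ∧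
    ∀ xs : Fin n → ℝ, IsGAVESolution A B b xs →
      ∀ M : Matrix (Fin n) (Fin n) ℝ, IsUnit M →
        ∀ ν : Seminorm ℝ (Fin n → ℝ), IsVectorNorm ν →
          ∃ κ : ℝ,
            IsGreatest ((fun D => inducedNorm ν (M * A + M * B * D)⁻¹) ''
              intervalMatrix (-1 : Matrix (Fin n) (Fin n) ℝ) 1) κ ∧
            ∀ x : Fin n → ℝ, ν (x - xs) ≤ κ * ν (M *ᵥ (gaveMap A B x - b)) := by
  refine ⟨(gaveMap_bijective hAB).existsUnique b, fun xs hxs M hM ν hν => ?_⟩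
  obtain ⟨κ, hκ⟩ := exists_isGreatest_inducedNorm_inv hAB hM hν
  refine ⟨κ, hκ, fun x => ?_⟩
  have h := norm_sub_le_mul_gaveMap hAB hM hν hκ.2 (t := 1) (by simp) x xs
  rwa [one_smul, show gaveMap A B xs = b from hxs] at h
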